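/- Let $M$ be a smooth manifold of dimension $4n$ with a hypercomplex structure $H=(J_1,J_2,J_3)$, i.e. a triple of integrable almost complex structures with $J_1J_2=-J_2J_1=J_3$, and a Riemannian metric $g$ with $g(J_s\cdot,J_s\cdot)=g(\cdot,\cdot)$ for $s=1,2,3$. Suppose that $(M,H,g)$ is an HKT manifold with HKT connection $\nabla$; that is, $\nabla$ is a linear connection with $\nabla g=0$ and $\nabla J_1=\nabla J_2=\nabla J_3=0$ whose torsion $T(X,Y)=\nabla_XY-\nabla_YX-[X,Y]$ is totally skew-symmetric, meaning that $T(X,Y,Z)=g(T(X,Y),Z)$ is a $3$-form. Then the Obata connection $\nabla^{ob}$ of $(M,H)$, i.e. the torsion-free linear connection with $\nabla^{ob}J_1=\nabla^{ob}J_2=\nabla^{ob}J_3=0$, exists, and it is related to $\nabla$ by $$g(\nabla^{ob}_XY,Z)=g(\nabla_XY,Z)+A(X,Y,Z)$$ for all vector fields $X,Y,Z$, where $$2A(X,Y,Z)=-T(X,J_1Y,J_1Z)-T(J_1X,J_1Y,Z)-T(X,J_3Y,J_3Z)-T(J_1X,J_3Y,J_2Z).$$ (The formula holds for every connection with the defining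 properties of $\nabla^{ob}$, so that it is unique.) -/

import Mathlib

open Bundle VectorField
open scoped Manifold ContDiff

noncomputable section

variable {E : Type*} [NormedAddCommGroup E] [NormedSpace ℝ E]
  {H : Type*} [TopologicalSpace H] {I : ModelWithCorners ℝ E H}
  {M : Type*} [TopologicalSpace M] [ChartedSpace H M]

/-- A smooth almost complex structure on `M`: a smooth field of endomorphisms `J` of the tangent
spaces with `J² = -id`. -/
structure AlmostComplexStructure (I : ModelWithCorners ℝ E H) (M : Type*) [TopologicalSpace M]
    [ChartedSpace H M] [IsManifold I 1 M] where
  /-- The endomorphism of each tangent space. -/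
  toFun : ∀ x : M, TangentSpace I x →L[ℝ] TangentSpace I x
  smooth : ContMDiff I (I.prod 𝓘(ℝ, E →L[ℝ] E)) ∞
    (fun x : M ↦ (TotalSpace.mk' (E →L[ℝ] E) x (toFun x) :
      TotalSpace (E →L[ℝ] E) (fun x : M ↦ TangentSpace I x →L[ℝ] TangentSpace I x)))
  sq : ∀ (x : M) (v : TangentSpace I x), toFun x (toFun x v) = -v

namespace AlmostComplexStructure

variable [IsManifold I 1 M]

instance : CoeFun (AlmostComplexStructure I M)
    fun _ ↦ ∀ x : M, TangentSpace I x →L[ℝ] TangentSpace I x := ⟨toFun⟩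

/-- The vector field `J X`. -/
def app (J : AlmostComplexStructure I M) (X : ∀ x : M, TangentSpace I x) :
    ∀ x : M, TangentSpace I x := fun x ↦ J x (X x)

/-- The Nijenhuis tensor `N_J(X, Y) = [JX, JY] - J[JX, Y] - J[X, JY] - [X, Y]`. -/
def nijenhuis (J : AlmostComplexStructure I M) (X Y : ∀ x : M, TangentSpace I x) (x : M) :
    TangentSpace I x :=
  mlieBracket I (J.app X) (J.app Y) x - J x (mlieBracket I (J.app X) Y x)
    - J x (mlieBracket I X (J.app Y) x) - mlieBracket I X Y x

/-- `J` is integrable (a complex structure): its Nijenhuis tensor vanishes. -/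
def IsIntegrable (J : AlmostComplexStructure I M) : Prop :=
  ∀ (X Y : ∀ x : M, TangentSpace I x) (x : M),
    MDiffAt (T% X) x → MDiffAt (T% Y) x → J.nijenhuis X Y x = 0

end AlmostComplexStructure

/-- A hypercomplex structure `(J₁, J₂, J₃)`: three integrable almost complex structures satisfying
`J₁ J₂ = -J₂ J₁ = J₃`. -/
structure HypercomplexStructure (I : ModelWithCorners ℝ E H) (M : Type*) [TopologicalSpace M]
    [ChartedSpace H M] [IsManifold I 1 M] where
  /-- The first complex structure. -/
  J₁ : AlmostComplexStructure I M
  /-- The second complex structure. -/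
  J₂ : AlmostComplexStructure I M
  /-- The third complex structure. -/
  J₃ : AlmostComplexStructure I M
  mul₁₂ : ∀ (x : M) (v : TangentSpace I x), J₁ x (J₂ x v) = J₃ x v
  mul₂₁ : ∀ (x : M) (v : TangentSpace I x), J₂ x (J₁ x v) = -J₃ x v
  integrable₁ : J₁.IsIntegrable
  integrable₂ : J₂.IsIntegrable
  integrable₃ : J₃.IsIntegrable

/-- A linear connection on `M`, written `∇ Y x v = (∇_v Y)(x)`, preserves `J`: the covariant
derivative `(∇_X J) Y = ∇_X (J Y) - J (∇_X Y)` vanishes. -/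
def Preserves [IsManifold I 1 M]
    (cov : CovariantDerivative I E (TangentSpace I : M → Type _))
    (J : AlmostComplexStructure I M) : Prop :=
  ∀ (Y : ∀ x : M, TangentSpace I x) (x : M) (v : TangentSpace I x),
    MDiffAt (T% Y) x → cov (J.app Y) x v = J x (cov Y x v)

/-- A smooth linear connection preserving all three complex structures. -/
structure IsHypercomplexConnection [IsManifold I 1 M] (S : HypercomplexStructure I M)
    (cov : CovariantDerivative I E (TangentSpace I : M → Type _)) : Prop where
  smooth : cov.ContMDiffCovariantDerivative ∞
  preserves₁ : Preserves cov S.J₁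
  preserves₂ : Preserves cov S.J₂
  preserves₃ : Preserves cov S.J₃

/-- An Obata connection of a hypercomplex structure: a torsion-free linear connection preserving
the three complex structures. -/
structure IsObataConnection [FiniteDimensional ℝ E] [IsManifold I 2 M] [IsManifold I 1 M]
    (S : HypercomplexStructure I M)
    (cov : CovariantDerivative I E (TangentSpace I : M → Type _)) : Prop
    extends IsHypercomplexConnection S cov where
  torsion_eq_zero : cov.torsion = 0

section Metric

variable [IsManifold I 1 M]

/-- The Riemannian metric `g` is Hermitian with respect to `J`: `g(J·, J·) = g(·, ·)`. -/
def IsHermitian (g : ContMDiffRiemannianMetric I ∞ E (TangentSpace I : M → Type _))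
    (J : AlmostComplexStructure I M) : Prop :=
  ∀ (x : M) (u v : TangentSpace I x), g.inner x (J x u) (J x v) = g.inner x u v

/-- The Riemannian metric `g` is hyperhermitian: it is Hermitian with respect to all three complex
structures. -/
structure IsHyperhermitian (g : ContMDiffRiemannianMetric I ∞ E (TangentSpace I : M → Type _))
    (S : HypercomplexStructure I M) : Prop where
  hermitian₁ : IsHermitian g S.J₁
  hermitian₂ : IsHermitian g S.J₂
  hermitian₃ : IsHermitian g S.J₃

/-- The connection preserves the metric: `v(g(Y, Z)) = g(∇_v Y, Z) + g(Y, ∇_v Z)`. -/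
def PreservesMetric (g : ContMDiffRiemannianMetric I ∞ E (TangentSpace I : M → Type _))
    (cov : CovariantDerivative I E (TangentSpace I : M → Type _)) : Prop :=
  ∀ (Y Z : ∀ x : M, TangentSpace I x) (x : M) (v : TangentSpace I x),
    MDiffAt (T% Y) x → MDiffAt (T% Z) x →
      mvfderiv I (fun y : M ↦ g.inner y (Y y) (Z y)) x v =
        g.inner x (cov Y x v) (Z x) + g.inner x (Y x) (cov Z x v)

variable [FiniteDimensional ℝ E] [IsManifold I 2 M]

/-- The torsion as a covariant 3-tensor, `T(u, v, w) = g(T(u, v), w)`, where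
`T(X, Y) = ∇_X Y - ∇_Y X - [X, Y]`. -/
def torsion₃ (g : ContMDiffRiemannianMetric I ∞ E (TangentSpace I : M → Type _))
    (cov : CovariantDerivative I E (TangentSpace I : M → Type _)) (x : M)
    (u v w : TangentSpace I x) : ℝ :=
  g.inner x (cov.torsion x u v) w

/-- An HKT connection: a linear connection preserving the hyperhermitian structure (the metric and
the three complex structures) whose torsion is totally skew-symmetric. -/
structure IsHKTConnection (g : ContMDiffRiemannianMetric I ∞ E (TangentSpace I : M → Type _))
    (S : HypercomplexStructure I M)
    (cov : CovariantDerivative I E (TangentSpace I : M → Type _)) : Prop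
    extends IsHypercomplexConnection S cov where
  metric : PreservesMetric g cov
  skew₁₂ : ∀ (x : M) (u v w : TangentSpace I x),
    torsion₃ g cov x u v w = -torsion₃ g cov x v u w
  skew₂₃ : ∀ (x : M) (u v w : TangentSpace I x),
    torsion₃ g cov x u v w = -torsion₃ g cov x u w v

/-- The tensor `A`, defined by
`2 A(X,Y,Z) = -T(X,J₁Y,J₁Z) - T(J₁X,J₁Y,Z) - T(X,J₃Y,J₃Z) - T(J₁X,J₃Y,J₂Z)`. -/
def differenceTensor (g : ContMDiffRiemannianMetric I ∞ E (TangentSpace I : M → Type _))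
    (S : HypercomplexStructure I M)
    (cov : CovariantDerivative I E (TangentSpace I : M → Type _)) (x : M)
    (X Y Z : TangentSpace I x) : ℝ :=
  (1 / 2 : ℝ) *
    (-torsion₃ g cov x X (S.J₁ x Y) (S.J₁ x Z)
      - torsion₃ g cov x (S.J₁ x X) (S.J₁ x Y) Z
      - torsion₃ g cov x X (S.J₃ x Y) (S.J₃ x Z)
      - torsion₃ g cov x (S.J₁ x X) (S.J₃ x Y) (S.J₂ x Z))

end Metric

end

/-! Two connections with the same torsion differ by a symmetric tensor, and if both preserve `J₁`
and `J₂`, this tensor is linear over `J₁` and `J₂` in either argument. Moving `J₁` and `J₂` out of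
different arguments gives `J₁ J₂ = J₂ J₁` on its values, which therefore vanish; so there is at most
one Obata connection.

For existence, let `T` be the torsion of a connection preserving the three structures. Integrability
of `J₁` says exactly that the endomorphism-valued form `v ↦ [T(J₁ v, ·), J₁]` is `J₁`-linear. Its
`J₂`-linear part is then linear over all three structures, and by integrability of `J₂` and `J₃` its
antisymmetrization is the torsion to be removed: adding it to the connection gives the Obata
connection. The tensor `A` is this form paired with the metric. -/

section SmoothSections

variable {E : Type*} [NormedAddCommGroup E] [NormedSpace ℝ E]
  {H : Type*} [TopologicalSpace H] {I : ModelWithCorners ℝ E H}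
  {M : Type*} [TopologicalSpace M] [ChartedSpace H M]
  {F : Type*} [NormedAddCommGroup F] [NormedSpace ℝ F]
  {F' : Type*} [NormedAddCommGroup F'] [NormedSpace ℝ F']
  {V : M → Type*} [TopologicalSpace (TotalSpace F V)] [∀ x, AddCommGroup (V x)]
  [∀ x, Module ℝ (V x)] [∀ x, TopologicalSpace (V x)] [FiberBundle F V] [VectorBundle ℝ F V]
  {W : M → Type*} [TopologicalSpace (TotalSpace F' W)] [∀ x, AddCommGroup (W x)]
  [∀ x, Module ℝ (W x)] [∀ x, TopologicalSpace (W x)] [FiberBundle F' W] [VectorBundle ℝ F' W]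

open scoped Topology in
lemma exists_contMDiff_section_eventuallyEq [FiniteDimensional ℝ E] [T2Space M] [IsManifold I ∞ M]
    {k : ℕ∞} {s : ∀ x : M, V x} {u : Set M} (hu : IsOpen u) (hs : CMDiff[u] k (T% s))
    {x : M} (hx : x ∈ u) :
    ∃ t : ∀ x : M, V x, CMDiff k (T% t) ∧ ∀ᶠ y in 𝓝 x, t y = s y := by
  obtain ⟨f, -, hf⟩ := (SmoothBumpFunction.nhds_basis_tsupport (I := I) x).mem_iff.1
    (hu.mem_nhds hx)
  have hf_smooth : CMDiff[u] k f := (f.contMDiff.of_le (mod_cast le_top)).contMDiffOn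
  refine ⟨(f : M → ℝ) • s, hf_smooth.smul_section_of_tsupport hu hf hs, ?_⟩
  filter_upwards [f.eventuallyEq_one] with y hy
  simp [hy]

lemma contMDiffAt_clm_of_forall_apply [FiniteDimensional ℝ F] {k : ℕ∞ω} {f : M → F →L[ℝ] F'}
    {x : M} (h : ∀ v, ContMDiffAt I 𝓘(ℝ, F') k (fun y ↦ f y v) x) :
    ContMDiffAt I 𝓘(ℝ, F →L[ℝ] F') k f x := by
  let b := Module.finBasis ℝ F
  have f_eq : f = fun y ↦ ∑ i, ContinuousLinearMap.smulRightL ℝ F F'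
      (LinearMap.toContinuousLinearMap (b.coord i)) (f y (b i)) := by
    ext y v
    conv_lhs => rw [← b.sum_repr v, map_sum]
    simp
  rw [f_eq]
  exact ContMDiffAt.sum fun i _ ↦
    (ContinuousLinearMap.contDiff _).contMDiff.contMDiffAt.comp x (h (b i))

lemma contMDiff_hom_section_of_forall_apply [FiniteDimensional ℝ E] [T2Space M] [IsManifold I ∞ M]
    [FiniteDimensional ℝ F] [∀ x, IsTopologicalAddGroup (W x)] [∀ x, ContinuousSMul ℝ (W x)]
    {k : ℕ∞} [ContMDiffVectorBundle k F V I]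
    {Φ : ∀ x : M, V x →L[ℝ] W x}
    (h : ∀ s : ∀ x : M, V x, CMDiff k (T% s) → CMDiff k (T% (fun x ↦ Φ x (s x)))) :
    ContMDiff I (I.prod 𝓘(ℝ, F →L[ℝ] F')) k
      (fun x ↦ (TotalSpace.mk' (F →L[ℝ] F') x (Φ x) :
        TotalSpace (F →L[ℝ] F') (fun x : M ↦ V x →L[ℝ] W x))) := by
  intro x₀
  rw [contMDiffAt_hom_bundle]
  refine ⟨contMDiffAt_id, contMDiffAt_clm_of_forall_apply fun v ↦ ?_⟩
  set e := trivializationAt F V x₀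
  set e' := trivializationAt F' W x₀
  have hx : x₀ ∈ e.baseSet := mem_baseSet_trivializationAt F V x₀
  have hx' : x₀ ∈ e'.baseSet := mem_baseSet_trivializationAt F' W x₀
  have hs : CMDiff[e.baseSet] k (T% (fun y ↦ e.symm y v)) := by
    rw [e.contMDiffOn_section_baseSet_iff]
    exact (contMDiffOn_const (c := v)).congr fun y hy ↦ by simp [hy]
  obtain ⟨t, ht, ht_eq⟩ := exists_contMDiff_section_eventuallyEq e.open_baseSet hs hx
  refine (contMDiffAt_totalSpace.1 (h t ht x₀)).2.congr_of_eventuallyEq ?_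
  filter_upwards [ht_eq, e.open_baseSet.mem_nhds hx, e'.open_baseSet.mem_nhds hx']
    with y hy hye hye'
  rw [ContinuousLinearMap.inCoordinates_eq hye hye']
  simp [hy, e, e']

end SmoothSections

section LinearAlgebra

variable {V : Type*} [AddCommGroup V] [Module ℝ V]

lemma eq_zero_of_symm_of_anticommute {F : Type*} [FunLike F V V] [AddMonoidHomClass F V V]
    {J K : F} {B : V → V → V} (symm : ∀ u v, B u v = B v u) (sqJ : ∀ v, J (J v) = -v)
    (sqK : ∀ v, K (K v) = -v) (anti : ∀ v, K (J v) = -J (K v))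
    (hJ : ∀ u v, B u (J v) = J (B u v)) (hK : ∀ u v, B u (K v) = K (B u v)) (u v : V) :
    B u v = 0 := by
  have commute : J (K (B u v)) = K (J (B u v)) := calc
    J (K (B u v)) = B (K v) (J u) := by rw [hJ, symm (K v), hK]
    _ = K (J (B u v)) := by rw [symm, hK, symm, hJ, symm]
  have JK_eq_neg : J (K (B u v)) = -J (K (B u v)) := commute.trans (anti _)
  have JK_eq_zero : J (K (B u v)) = 0 := by
    linear_combination (norm := module) (1 / 2 : ℝ) • JK_eq_neg
  simpa [sqJ, sqK] using congrArg (fun w ↦ K (J w)) JK_eq_zero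

variable [TopologicalSpace V]

section ComplexLinearPart

variable {W : Type*} [AddCommGroup W] [Module ℝ W] [TopologicalSpace W]
  [IsTopologicalAddGroup W] [ContinuousSMul ℝ W]

/-- The complex linear part of a real linear map `B`, where `J` and `K` are the complex structures
of its source and target. -/
noncomputable def complexLinearPart (J : V →L[ℝ] V) (K : W →L[ℝ] W) (B : V →L[ℝ] W) : V →L[ℝ] W :=
  (1 / 2 : ℝ) • (B - K ∘L B ∘L J)

variable {J J' : V →L[ℝ] V} {K K' : W →L[ℝ] W} {B : V →L[ℝ] W}

lemma complexLinearPart_apply (v : V) :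
    complexLinearPart J K B v = (1 / 2 : ℝ) • (B v - K (B (J v))) := by
  simp [complexLinearPart]

lemma complexLinearPart_map (sqJ : ∀ v, J (J v) = -v) (sqK : ∀ w, K (K w) = -w) (v : V) :
    complexLinearPart J K B (J v) = K (complexLinearPart J K B v) := by
  simp only [complexLinearPart_apply, sqJ, sqK, map_smul, map_sub, map_neg]
  module

lemma complexLinearPart_map_of_anticommute (hJ : ∀ v, J (J' v) = -J' (J v))
    (hK : ∀ w, K (K' w) = -K' (K w)) (hB : ∀ v, B (J' v) = K' (B v)) (v : V) :
    complexLinearPart J K B (J' v) = K' (complexLinearPart J K B v) := by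
  simp only [complexLinearPart_apply, hJ, hK, hB, map_smul, map_sub, map_neg, neg_neg]

end ComplexLinearPart

variable [IsTopologicalAddGroup V] [ContinuousSMul ℝ V]

/-- The `(0, 2)`-part of the vector-valued bilinear map `T` with respect to the complex structure
`J` vanishes. That part is a quarter of the difference of the two sides. -/
def HasNoZeroTwoPart (J : V →L[ℝ] V) (T : V →L[ℝ] V →L[ℝ] V) : Prop :=
  ∀ u v, T u v = T (J u) (J v) - J (T (J u) v) - J (T u (J v))

/-- The endomorphism-valued form `v ↦ [T(J v, ·), J]`, which is complex linear if `T` has no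
`(0, 2)`-part. -/
noncomputable def commutatorForm (J : V →L[ℝ] V) (T : V →L[ℝ] V →L[ℝ] V) : V →L[ℝ] V →L[ℝ] V :=
  (ContinuousLinearMap.precomp V J - ContinuousLinearMap.postcomp V J) ∘L T ∘L J

/-- The form which, added to a connection of torsion `T` preserving the anticommuting complex
structures `J` and `K`, removes the torsion: the `K`-linear part of `commutatorForm J T`. The first
argument is the differentiated vector, the second one the direction of differentiation. -/
noncomputable def obataTensor (J K : V →L[ℝ] V) (T : V →L[ℝ] V →L[ℝ] V) : V →L[ℝ] V →L[ℝ] V :=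
  complexLinearPart K (ContinuousLinearMap.postcomp V K) (commutatorForm J T)

variable {J K : V →L[ℝ] V} {T : V →L[ℝ] V →L[ℝ] V}

lemma commutatorForm_apply (v u : V) :
    commutatorForm J T v u = T (J v) (J u) - J (T (J v) u) := by
  simp [commutatorForm]

lemma HasNoZeroTwoPart.commutatorForm_map (hT : HasNoZeroTwoPart J T) (sqJ : ∀ v, J (J v) = -v)
    (v : V) : commutatorForm J T (J v) = J ∘L commutatorForm J T v := by
  ext u
  have J_type := congrArg J (hT v u)
  simp only [map_sub, sqJ] at J_type
  simp only [ContinuousLinearMap.comp_apply, commutatorForm_apply, sqJ, map_sub, map_neg,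
    _root_.neg_apply]
  linear_combination (norm := module) J_type

lemma HasNoZeroTwoPart.commutatorForm_sub_swap (hT : HasNoZeroTwoPart J T)
    (skew : ∀ u v, T u v = -T v u) (v u : V) :
    commutatorForm J T v u - commutatorForm J T u v = T v u + T (J v) (J u) := by
  rw [commutatorForm_apply, commutatorForm_apply, skew (J u) (J v), skew (J u) v, map_neg]
  linear_combination (norm := module) -hT v u

lemma obataTensor_apply (v u : V) :
    obataTensor J K T v u =
      (1 / 2 : ℝ) • (commutatorForm J T v u - K (commutatorForm J T (K v) u)) := by
  simp [obataTensor, complexLinearPart_apply]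

lemma HasNoZeroTwoPart.obataTensor_map (hT : HasNoZeroTwoPart J T) (sqJ : ∀ v, J (J v) = -v)
    (anti : ∀ v, K (J v) = -J (K v)) (v : V) :
    obataTensor J K T (J v) = J ∘L obataTensor J K T v :=
  complexLinearPart_map_of_anticommute (K' := ContinuousLinearMap.postcomp V J) anti
    (fun w ↦ by ext u; simp [anti]) (hT.commutatorForm_map sqJ) v

lemma obataTensor_map (sqK : ∀ v, K (K v) = -v) (v : V) :
    obataTensor J K T (K v) = K ∘L obataTensor J K T v :=
  complexLinearPart_map sqK (fun w ↦ by ext u; simp [sqK]) v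

lemma obataTensor_sub_swap (anti : ∀ v, K (J v) = -J (K v)) (skew : ∀ u v, T u v = -T v u)
    (hJ : HasNoZeroTwoPart J T) (hK : HasNoZeroTwoPart K T) (hJK : HasNoZeroTwoPart (J ∘L K) T)
    (v u : V) : obataTensor J K T v u - obataTensor J K T u v = T v u := by
  have K_type := hK (J v) (J u)
  have JK_type := hJK v u
  simp only [anti, map_neg, _root_.neg_apply] at K_type
  simp only [ContinuousLinearMap.comp_apply] at JK_type
  have swapped : K (commutatorForm J T (K v) u) - K (commutatorForm J T (K u) v) =
      T (J v) (J u) - T v u := by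
    rw [commutatorForm_apply, commutatorForm_apply, skew (J (K u)) (J v), skew (J (K u)) v]
    simp only [map_sub, map_neg, anti]
    linear_combination (norm := module) JK_type - K_type
  rw [obataTensor_apply, obataTensor_apply]
  linear_combination (norm := module)
    (1 / 2 : ℝ) • hJ.commutatorForm_sub_swap skew v u - (1 / 2 : ℝ) • swapped

end LinearAlgebra

section Connections

variable {E : Type*} [NormedAddCommGroup E] [NormedSpace ℝ E]
  {H : Type*} [TopologicalSpace H] {I : ModelWithCorners ℝ E H}
  {M : Type*} [TopologicalSpace M] [ChartedSpace H M]

namespace AlmostComplexStructure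

variable [IsManifold I 1 M] (J : AlmostComplexStructure I M) {X : ∀ x : M, TangentSpace I x}

lemma mdifferentiableAt_app {x : M} (hX : MDiffAt (T% X) x) : MDiffAt (T% (J.app X)) x :=
  ((J.smooth x).mdifferentiableAt (by simp)).clm_bundle_apply hX

lemma contMDiff_app (hX : CMDiff ∞ (T% X)) : CMDiff ∞ (T% (J.app X)) :=
  J.smooth.clm_bundle_apply hX

end AlmostComplexStructure

lemma exists_mdifferentiableAt_vectorField_eq [IsManifold I 1 M] {x : M} (v : TangentSpace I x) :
    ∃ X : ∀ x : M, TangentSpace I x, MDiffAt (T% X) x ∧ X x = v :=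
  ⟨FiberBundle.extend E v, FiberBundle.mdifferentiableAt_extend .., by simp⟩

lemma difference_apply_vectorField [FiniteDimensional ℝ E] [IsManifold I 2 M]
    (cov cov' : CovariantDerivative I E (TangentSpace I : M → Type _))
    {X : ∀ x : M, TangentSpace I x} {x : M} (hX : MDiffAt (T% X) x) :
    cov.difference cov' x (X x) = cov X x - cov' X x :=
  IsCovariantDerivativeOn.difference_apply _ _ (Set.mem_univ x) hX

lemma difference_sub_swap [FiniteDimensional ℝ E] [IsManifold I 2 M]
    (cov cov' : CovariantDerivative I E (TangentSpace I : M → Type _)) (x : M)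
    (u v : TangentSpace I x) :
    cov.difference cov' x v u - cov.difference cov' x u v =
      cov.torsion x u v - cov'.torsion x u v := by
  obtain ⟨X, hX, rfl⟩ := exists_mdifferentiableAt_vectorField_eq u
  obtain ⟨Y, hY, rfl⟩ := exists_mdifferentiableAt_vectorField_eq v
  rw [difference_apply_vectorField cov cov' hX, difference_apply_vectorField cov cov' hY,
    cov.torsion_apply hX hY, cov'.torsion_apply hX hY, sub_apply, sub_apply]
  module

lemma torsion_addOneForm [FiniteDimensional ℝ E] [IsManifold I 2 M]
    (cov : CovariantDerivative I E (TangentSpace I : M → Type _))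
    (A : ∀ x : M, TangentSpace I x →L[ℝ] TangentSpace I x →L[ℝ] TangentSpace I x) (x : M)
    (u v : TangentSpace I x) :
    (cov.addOneForm A).torsion x u v = cov.torsion x u v + (A x v u - A x u v) := by
  obtain ⟨X, hX, rfl⟩ := exists_mdifferentiableAt_vectorField_eq u
  obtain ⟨Y, hY, rfl⟩ := exists_mdifferentiableAt_vectorField_eq v
  rw [(cov.addOneForm A).torsion_apply hX hY, cov.torsion_apply hX hY]
  change cov Y x (X x) + A x (Y x) (X x) - (cov X x (Y x) + A x (X x) (Y x)) - _ = _
  module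

lemma contMDiff_torsion_apply [FiniteDimensional ℝ E] [IsManifold I ∞ M]
    {cov : CovariantDerivative I E (TangentSpace I : M → Type _)}
    (hcov : cov.ContMDiffCovariantDerivative ∞) {X Y : ∀ x : M, TangentSpace I x}
    (hX : CMDiff ∞ (T% X)) (hY : CMDiff ∞ (T% Y)) :
    CMDiff ∞ (T% (fun x ↦ cov.torsion x (X x) (Y x))) := by
  have torsion_eq (x : M) : cov.torsion x (X x) (Y x) =
      cov Y x (X x) - cov X x (Y x) - mlieBracket I X Y x :=
    cov.torsion_apply ((hX x).mdifferentiableAt (by simp)) ((hY x).mdifferentiableAt (by simp))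
  have smooth_cov {Z W : ∀ x : M, TangentSpace I x} (hZ : CMDiff ∞ (T% Z))
      (hW : CMDiff ∞ (T% W)) : CMDiff ∞ (T% (fun x ↦ cov Z x (W x))) :=
    (contMDiffOn_univ.1 (hcov.contMDiff.contMDiff (contMDiffOn_univ.2 hZ))).clm_bundle_apply hW
  have : IsManifold I (minSmoothness ℝ 2) M := by
    rw [minSmoothness_of_isRCLikeNormedField]
    infer_instance
  have : IsManifold I ((⊤ : ℕ∞) + 1) M := ‹IsManifold I ∞ M›
  have smooth_bracket : CMDiff ∞ (T% (mlieBracket I X Y)) :=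
    ContDiff.mlieBracket_vectorField (m := ⊤) (n := ⊤) hX hY (by simp)
  simp_rw [torsion_eq]
  exact ((smooth_cov hY hX).sub_section (smooth_cov hX hY)).sub_section smooth_bracket

lemma contMDiffCovariantDerivative_addOneForm [FiniteDimensional ℝ E] [T2Space M]
    [IsManifold I ∞ M] {cov : CovariantDerivative I E (TangentSpace I : M → Type _)}
    (hcov : cov.ContMDiffCovariantDerivative ∞)
    {A : ∀ x : M, TangentSpace I x →L[ℝ] TangentSpace I x →L[ℝ] TangentSpace I x}
    (hA : ∀ Y X : ∀ x : M, TangentSpace I x, CMDiff ∞ (T% Y) → CMDiff ∞ (T% X) →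
      CMDiff ∞ (T% (fun x ↦ A x (Y x) (X x)))) :
    (cov.addOneForm A).ContMDiffCovariantDerivative ∞ := by
  refine ⟨⟨fun {Y} hY ↦ ?_⟩⟩
  have smooth_cov := hcov.contMDiff.contMDiff hY
  rw [contMDiffOn_univ] at hY smooth_cov ⊢
  exact smooth_cov.add_section
    (contMDiff_hom_section_of_forall_apply fun X hX ↦ hA Y X hY hX)

namespace Preserves

section

variable [IsManifold I 1 M] {cov : CovariantDerivative I E (TangentSpace I : M → Type _)}
  {J K : AlmostComplexStructure I M}

lemma of_mul {L : AlmostComplexStructure I M} (hJ : Preserves cov J) (hK : Preserves cov K)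
    (hL : ∀ (x : M) (v : TangentSpace I x), J x (K x v) = L x v) : Preserves cov L := by
  intro Y x v hY
  have app_eq : L.app Y = J.app (K.app Y) := funext fun y ↦ (hL y (Y y)).symm
  rw [app_eq, hJ _ x v (K.mdifferentiableAt_app hY), hK Y x v hY, hL]

lemma addOneForm (hJ : Preserves cov J)
    {A : ∀ x : M, TangentSpace I x →L[ℝ] TangentSpace I x →L[ℝ] TangentSpace I x}
    (hA : ∀ (x : M) (v : TangentSpace I x), A x (J x v) = J x ∘L A x v) :
    Preserves (cov.addOneForm A) J := by
  intro Y x v hY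
  change cov (J.app Y) x v + A x (J x (Y x)) v = J x (cov Y x v + A x (Y x) v)
  rw [hJ Y x v hY, hA, ContinuousLinearMap.comp_apply, map_add]

end

variable [FiniteDimensional ℝ E] [IsManifold I 2 M]
  {cov cov' : CovariantDerivative I E (TangentSpace I : M → Type _)}
  {J K : AlmostComplexStructure I M}

lemma difference_map (h : Preserves cov J) (h' : Preserves cov' J) (x : M)
    (u v : TangentSpace I x) :
    cov.difference cov' x (J x v) u = J x (cov.difference cov' x v u) := by
  obtain ⟨Y, hY, rfl⟩ := exists_mdifferentiableAt_vectorField_eq v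
  calc
    cov.difference cov' x (J.app Y x) u = cov (J.app Y) x u - cov' (J.app Y) x u := by
      rw [difference_apply_vectorField cov cov' (J.mdifferentiableAt_app hY), sub_apply]
    _ = J x (cov Y x u - cov' Y x u) := by rw [h Y x u hY, h' Y x u hY, map_sub]
    _ = J x (cov.difference cov' x (Y x) u) := by
      rw [difference_apply_vectorField cov cov' hY, sub_apply]

/-- This is the vanishing of the Nijenhuis tensor, with the Lie brackets expressed through the
connection and its torsion. -/
lemma hasNoZeroTwoPart_torsion (hJ : Preserves cov J)
    (hint : J.IsIntegrable) (x : M) : HasNoZeroTwoPart (J x) (cov.torsion x) := by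
  intro u v
  obtain ⟨X, hX, rfl⟩ := exists_mdifferentiableAt_vectorField_eq u
  obtain ⟨Y, hY, rfl⟩ := exists_mdifferentiableAt_vectorField_eq v
  have hJX := J.mdifferentiableAt_app hX
  have hJY := J.mdifferentiableAt_app hY
  have torsion_X_Y := cov.torsion_apply hX hY
  have torsion_JX_JY := cov.torsion_apply hJX hJY
  have J_torsion_JX_Y := congrArg (J x) (cov.torsion_apply hJX hY)
  have J_torsion_X_JY := congrArg (J x) (cov.torsion_apply hX hJY)
  have nijenhuis_eq_zero := hint X Y x hX hY
  simp only [hJ _ _ _ hX, hJ _ _ _ hY, map_sub, AlmostComplexStructure.nijenhuis,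
    AlmostComplexStructure.app, J.sq]
    at torsion_JX_JY J_torsion_JX_Y J_torsion_X_JY nijenhuis_eq_zero
  rw [torsion_X_Y, torsion_JX_JY, J_torsion_JX_Y, J_torsion_X_JY]
  linear_combination (norm := module) nijenhuis_eq_zero

theorem eq_of_torsion_eq
    (anti : ∀ (x : M) (v : TangentSpace I x), K x (J x v) = -J x (K x v))
    (hJ : Preserves cov J) (hJ' : Preserves cov' J) (hK : Preserves cov K) (hK' : Preserves cov' K)
    (htorsion : cov.torsion = cov'.torsion) {Y : ∀ x : M, TangentSpace I x} {x : M}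
    (hY : MDiffAt (T% Y) x) : cov Y x = cov' Y x := by
  have difference_symm (u v : TangentSpace I x) :
      cov.difference cov' x v u = cov.difference cov' x u v := by
    rw [← sub_eq_zero, difference_sub_swap, htorsion, sub_self]
  ext v
  have difference_eq_zero : cov.difference cov' x (Y x) v = 0 :=
    eq_zero_of_symm_of_anticommute (B := fun u w ↦ cov.difference cov' x w u) difference_symm
      (J.sq x) (K.sq x) (anti x) (hJ.difference_map hJ' x) (hK.difference_map hK' x) v (Y x)
  rwa [difference_apply_vectorField cov cov' hY, sub_apply, sub_eq_zero] at difference_eq_zero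

end Preserves

lemma HypercomplexStructure.mul₂₁_eq_neg_mul₁₂ [IsManifold I 1 M]
    (S : HypercomplexStructure I M) (x : M) (v : TangentSpace I x) :
    S.J₂ x (S.J₁ x v) = -S.J₁ x (S.J₂ x v) := by
  rw [S.mul₂₁, S.mul₁₂]

lemma IsHermitian.inner_apply_left [IsManifold I 1 M]
    {g : ContMDiffRiemannianMetric I ∞ E (TangentSpace I : M → Type _)}
    {J : AlmostComplexStructure I M} (h : IsHermitian g J) (x : M) (u v : TangentSpace I x) :
    g.inner x (J x u) v = -g.inner x u (J x v) := by
  rw [← h x (J x u) v, J.sq, map_neg, _root_.neg_apply]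

end Connections

section Obata

variable {E : Type*} [NormedAddCommGroup E] [NormedSpace ℝ E] [FiniteDimensional ℝ E]
  {H : Type*} [TopologicalSpace H] {I : ModelWithCorners ℝ E H}
  {M : Type*} [TopologicalSpace M] [ChartedSpace H M]

namespace HypercomplexStructure

section ObataForm

variable [IsManifold I 2 M] (S : HypercomplexStructure I M)
  (cov : CovariantDerivative I E (TangentSpace I : M → Type _))

/-- The endomorphism-valued one-form by which the Obata connection differs from the hypercomplex
connection `cov`. As in `CovariantDerivative.addOneForm`, the differentiated vector is the first
argument. -/
noncomputable def obataForm (x : M) :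
    TangentSpace I x →L[ℝ] TangentSpace I x →L[ℝ] TangentSpace I x :=
  obataTensor (S.J₁ x) (S.J₂ x) (cov.torsion x)

lemma obataForm_apply (x : M) (v u : TangentSpace I x) :
    S.obataForm cov x v u = (1 / 2 : ℝ) •
      (cov.torsion x (S.J₁ x v) (S.J₁ x u) - S.J₁ x (cov.torsion x (S.J₁ x v) u)
        - S.J₃ x (cov.torsion x (S.J₃ x v) u) - S.J₂ x (cov.torsion x (S.J₃ x v) (S.J₁ x u))) := by
  simp only [obataForm, obataTensor_apply, commutatorForm_apply, map_sub, S.mul₁₂, S.mul₂₁]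
  module

lemma inner_obataForm {g : ContMDiffRiemannianMetric I ∞ E (TangentSpace I : M → Type _)}
    (hg : IsHyperhermitian g S) (x : M) (u v w : TangentSpace I x) :
    g.inner x (S.obataForm cov x v u) w = differenceTensor g S cov x u v w := by
  rw [obataForm_apply, cov.torsion_antisymm (S.J₁ x v) (S.J₁ x u),
    cov.torsion_antisymm (S.J₁ x v) u, cov.torsion_antisymm (S.J₃ x v) u,
    cov.torsion_antisymm (S.J₃ x v) (S.J₁ x u)]
  simp only [map_smul, map_sub, map_neg, smul_apply, sub_apply, _root_.neg_apply,
    hg.hermitian₁.inner_apply_left, hg.hermitian₂.inner_apply_left, hg.hermitian₃.inner_apply_left,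
    differenceTensor, torsion₃, smul_eq_mul]
  ring

end ObataForm

lemma contMDiff_obataForm_apply [IsManifold I ∞ M] (S : HypercomplexStructure I M)
    {cov : CovariantDerivative I E (TangentSpace I : M → Type _)}
    (hcov : cov.ContMDiffCovariantDerivative ∞) {X Y : ∀ x : M, TangentSpace I x}
    (hY : CMDiff ∞ (T% Y)) (hX : CMDiff ∞ (T% X)) :
    CMDiff ∞ (T% (fun x ↦ S.obataForm cov x (Y x) (X x))) := by
  have smooth_torsion {Z W : ∀ x : M, TangentSpace I x} :=
    contMDiff_torsion_apply hcov (X := Z) (Y := W)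
  have hX₁ := S.J₁.contMDiff_app hX
  have hY₁ := S.J₁.contMDiff_app hY
  have hY₃ := S.J₃.contMDiff_app hY
  simp_rw [obataForm_apply]
  exact (((smooth_torsion hY₁ hX₁).sub_section
    (S.J₁.contMDiff_app (smooth_torsion hY₁ hX))).sub_section
    (S.J₃.contMDiff_app (smooth_torsion hY₃ hX))).sub_section
    (S.J₂.contMDiff_app (smooth_torsion hY₃ hX₁)) |>.const_smul_section

end HypercomplexStructure

theorem IsHypercomplexConnection.isObataConnection_addOneForm [T2Space M] [IsManifold I ∞ M]
    {S : HypercomplexStructure I M}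
    {cov : CovariantDerivative I E (TangentSpace I : M → Type _)}
    (h : IsHypercomplexConnection S cov) :
    IsObataConnection S (cov.addOneForm (S.obataForm cov)) := by
  have type₁ := h.preserves₁.hasNoZeroTwoPart_torsion S.integrable₁
  have type₂ := h.preserves₂.hasNoZeroTwoPart_torsion S.integrable₂
  have type₃ := h.preserves₃.hasNoZeroTwoPart_torsion S.integrable₃
  have J₁_mul_J₂ (x : M) : S.J₁ x ∘L S.J₂ x = S.J₃ x := ContinuousLinearMap.ext (S.mul₁₂ x)
  have preserves₁ : Preserves (cov.addOneForm (S.obataForm cov)) S.J₁ :=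
    h.preserves₁.addOneForm fun x ↦
      (type₁ x).obataTensor_map (S.J₁.sq x) (S.mul₂₁_eq_neg_mul₁₂ x)
  have preserves₂ : Preserves (cov.addOneForm (S.obataForm cov)) S.J₂ :=
    h.preserves₂.addOneForm fun x ↦ obataTensor_map (S.J₂.sq x)
  refine ⟨⟨?_, preserves₁, preserves₂, preserves₁.of_mul preserves₂ S.mul₁₂⟩, ?_⟩
  · exact contMDiffCovariantDerivative_addOneForm h.smooth
      fun _ _ ↦ S.contMDiff_obataForm_apply h.smooth
  · ext x u v
    have sub_swap : S.obataForm cov x v u - S.obataForm cov x u v = cov.torsion x v u :=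
      obataTensor_sub_swap (S.mul₂₁_eq_neg_mul₁₂ x) cov.torsion_antisymm (type₁ x) (type₂ x)
        (J₁_mul_J₂ x ▸ type₃ x) v u
    rw [torsion_addOneForm, sub_swap, cov.torsion_antisymm u v, neg_add_cancel]
    rfl

theorem IsObataConnection.eq_of_mdifferentiableAt [IsManifold I 2 M]
    {S : HypercomplexStructure I M}
    {cov cov' : CovariantDerivative I E (TangentSpace I : M → Type _)}
    (h : IsObataConnection S cov) (h' : IsObataConnection S cov')
    {Y : ∀ x : M, TangentSpace I x} {x : M} (hY : MDiffAt (T% Y) x) : cov Y x = cov' Y x :=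
  Preserves.eq_of_torsion_eq S.mul₂₁_eq_neg_mul₁₂ h.preserves₁ h'.preserves₁ h.preserves₂
    h'.preserves₂ (h.torsion_eq_zero.trans h'.torsion_eq_zero.symm) hY

theorem IsObataConnection.apply_eq_add_obataForm [T2Space M] [IsManifold I ∞ M]
    {S : HypercomplexStructure I M}
    {cov covOb : CovariantDerivative I E (TangentSpace I : M → Type _)}
    (hOb : IsObataConnection S covOb) (h : IsHypercomplexConnection S cov)
    {Y : ∀ x : M, TangentSpace I x} {x : M} (hY : MDiffAt (T% Y) x) :
    covOb Y x = cov Y x + S.obataForm cov x (Y x) :=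
  hOb.eq_of_mdifferentiableAt h.isObataConnection_addOneForm hY

theorem mainTheorem6_general [T2Space M] [IsManifold I ∞ M]
    {g : ContMDiffRiemannianMetric I ∞ E (TangentSpace I : M → Type _)}
    {S : HypercomplexStructure I M} (hg : IsHyperhermitian g S)
    {cov : CovariantDerivative I E (TangentSpace I : M → Type _)}
    (h : IsHypercomplexConnection S cov) :
    (∃ covOb : CovariantDerivative I E (TangentSpace I : M → Type _), IsObataConnection S covOb) ∧
    ∀ covOb : CovariantDerivative I E (TangentSpace I : M → Type _), IsObataConnection S covOb →
      ∀ (Y : ∀ x : M, TangentSpace I x) (x : M) (v w : TangentSpace I x), MDiffAt (T% Y) x →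
        g.inner x (covOb Y x v) w =
          g.inner x (cov Y x v) w + differenceTensor g S cov x v (Y x) w := by
  refine ⟨⟨_, h.isObataConnection_addOneForm⟩, fun covOb hOb Y x v w hY ↦ ?_⟩
  rw [hOb.apply_eq_add_obataForm h hY, add_apply, map_add, add_apply, S.inner_obataForm cov hg]

end Obata

theorem mainTheorem6 (n : ℕ) {M : Type*} [TopologicalSpace M] [T2Space M]
    [SecondCountableTopology M]
    [ChartedSpace (EuclideanSpace ℝ (Fin (4 * n))) M] [IsManifold (𝓡 (4 * n)) ∞ M]
    (g : ContMDiffRiemannianMetric (𝓡 (4 * n)) ∞ (EuclideanSpace ℝ (Fin (4 * n)))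
      (TangentSpace (𝓡 (4 * n)) : M → Type _))
    (S : HypercomplexStructure (𝓡 (4 * n)) M) (hgS : IsHyperhermitian g S)
    (nabla : CovariantDerivative (𝓡 (4 * n)) (EuclideanSpace ℝ (Fin (4 * n)))
      (TangentSpace (𝓡 (4 * n)) : M → Type _))
    (hnabla : IsHKTConnection g S nabla) :
    (∃ nablaOb : CovariantDerivative (𝓡 (4 * n)) (EuclideanSpace ℝ (Fin (4 * n)))
      (TangentSpace (𝓡 (4 * n)) : M → Type _), IsObataConnection S nablaOb) ∧
    ∀ nablaOb : CovariantDerivative (𝓡 (4 * n)) (EuclideanSpace ℝ (Fin (4 * n)))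
      (TangentSpace (𝓡 (4 * n)) : M → Type _), IsObataConnection S nablaOb →
      ∀ (X Y Z : ∀ x : M, TangentSpace (𝓡 (4 * n)) x) (x : M),
        MDifferentiableAt (𝓡 (4 * n)) (𝓡 (4 * n)).tangent
          (fun y : M ↦ (⟨y, Y y⟩ : TangentBundle (𝓡 (4 * n)) M)) x →
        g.inner x (nablaOb Y x (X x)) (Z x) =
          g.inner x (nabla Y x (X x)) (Z x)
            + differenceTensor g S nabla x (X x) (Y x) (Z x) := by
  have ⟨existence, formula⟩ := mainTheorem6_general hgS hnabla.toIsHypercomplexConnection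
  exact ⟨existence, fun nablaOb hOb X Y Z x ↦ formula nablaOb hOb Y x (X x) (Z x)⟩
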